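/- Let $A$ be a von Neumann algebra with a normal state $\varphi$, and let $A\,\bar\otimes\,A$ be the von Neumann algebra tensor product with the product state $\varphi\otimes\varphi$. The free cumulants $(k_n)_{n\ge 1}$ of a non-commutative probability space $(B,\psi)$ are the maps $k_n\colon B^n\to\mathbb C$ determined by $$\psi(b_1\cdots b_n)=\sum_{\pi\in NC(n)}\ \prod_{V=\{v_1<\dots<v_r\}\in\pi}k_r[b_{v_1},\dots,b_{v_r}],$$ where $NC(n)$ is the set of non-crossing partitions of $\{1,\dots,n\}$; write $k_n(b)=k_n[b,\dots,b]$. A standard semicircular is a self-adjoint element whose distribution is the semicircle law $\frac1{2\pi}\sqrt{4-t^2}\,\mathbf 1_{[-2,2]}(t)\,dt$. A (multi-component) meander with $2m$ bridges is a finite system of pairwise disjoint simple closed curves in the plane crossing a fixed infinite line (the river) transversally in exactly $2m$ points (the bridges), each curve crossing it at least once, considered up to deformations which preserve the river and the order of the bridges; equivalently, it is a pair of non-crossing perfect matchings of $\{1,\dots,2m\}$ (the arcs above and below the river), whose components are the classes of bridges connected by arcs. It is $k$-reducible if a proper non-empty collection of its components can be detached from the others by cutting the river at at most $k$ places between bridges,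 i.e. if after these cuts no piece of the river carries both bridges of the collection and bridges of the remaining components. Otherwise it is $k$-irreducible. Let $q_m$ be the number of $2$-irreducible meanders with $2m$ bridges. Let $\xi,\eta\in A$ be free standard semicirculars. Then the free cumulants of $\xi\otimes\eta$ in $(A\,\bar\otimes\,A,\varphi\otimes\varphi)$ are $$k_n(\xi\otimes\eta)=\begin{cases}q_m & \text{if } n=2m,\ m\ge 1,\\ 0 & \text{if } n \text{ is odd.}\end{cases}$$ -/

import Mathlib

open scoped TensorProduct

universe u v

set_option linter.unusedSectionVars false

/-! ### Von Neumann algebras and their tensor products -/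

namespace VonNeumannAlgebra

section Basic

variable {H : Type u} [NormedAddCommGroup H] [InnerProductSpace ℂ H] [CompleteSpace H]

/-- The (unital) von Neumann algebra generated by a set `s` of bounded operators: the double
commutant of `s ∪ star s`. -/
noncomputable def generatedBy (s : Set (H →L[ℂ] H)) : VonNeumannAlgebra H where
  toStarSubalgebra := StarSubalgebra.centralizer ℂ
    (StarSubalgebra.centralizer ℂ s : Set (H →L[ℂ] H))
  centralizer_centralizer' := by simp

theorem subset_generatedBy (s : Set (H →L[ℂ] H)) :
    s ⊆ ((generatedBy s).toStarSubalgebra : Set (H →L[ℂ] H)) := by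
  intro x hx
  simp only [generatedBy, StarSubalgebra.coe_centralizer]
  rw [Set.mem_centralizer_iff]
  intro y hy
  have key : ∀ z ∈ Set.centralizer (s ∪ star s), x * z = z * x := fun z hz =>
    (Set.mem_centralizer_iff.1 hz) x (Or.inl hx)
  have key' : ∀ z ∈ Set.centralizer (s ∪ star s), star x * z = z * star x := fun z hz =>
    (Set.mem_centralizer_iff.1 hz) (star x) (Or.inr (by simpa using hx))
  rcases hy with hy | hy
  · exact (key y hy).symm
  · have h := congrArg star (key' _ hy)
    simpa using h

end Basic

/-- The Hilbert space tensor product: the completion of the algebraic tensor product with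
`⟪x ⊗ y, x' ⊗ y'⟫ = ⟪x, x'⟫ ⟪y, y'⟫`. -/
abbrev HilbertTensor (H : Type u) (K : Type v)
    [NormedAddCommGroup H] [InnerProductSpace ℂ H]
    [NormedAddCommGroup K] [InnerProductSpace ℂ K] : Type (max u v) :=
  UniformSpace.Completion (H ⊗[ℂ] K)

section Tensor

variable {H : Type u} [NormedAddCommGroup H] [InnerProductSpace ℂ H] [CompleteSpace H]
variable {K : Type v} [NormedAddCommGroup K] [InnerProductSpace ℂ K] [CompleteSpace K]

/-- The vector `x ⊗ y` of the Hilbert space tensor product. -/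
noncomputable def tensorVec (x : H) (y : K) : HilbertTensor H K :=
  ((x ⊗ₜ[ℂ] y : H ⊗[ℂ] K) : UniformSpace.Completion (H ⊗[ℂ] K))

/-- The bounded operator `a ⊗ b` on the Hilbert space tensor product, determined by
`(a ⊗ b) (x ⊗ y) = a x ⊗ b y`. -/
noncomputable def tensorOp (a : H →L[ℂ] H) (b : K →L[ℂ] K) :
    HilbertTensor H K →L[ℂ] HilbertTensor H K :=
  (TensorProduct.mapL a b).completion

theorem tensorOp_tensorVec (a : H →L[ℂ] H) (b : K →L[ℂ] K) (x : H) (y : K) :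
    tensorOp a b (tensorVec x y) = tensorVec (a x) (b y) := by
  simp [tensorOp, tensorVec, ContinuousLinearMap.completion_apply_coe]

theorem inner_tensorVec (x x' : H) (y y' : K) :
    inner ℂ (tensorVec x y) (tensorVec x' y') = inner ℂ x x' * inner ℂ y y' := by
  simp [tensorVec]

theorem norm_tensorVec (x : H) (y : K) : ‖tensorVec x y‖ = ‖x‖ * ‖y‖ := by
  simp [tensorVec]

/-- The von Neumann algebra tensor product of `A` and `B`: the von Neumann algebra on the Hilbert
space tensor product generated by the operators `a ⊗ b`, `a ∈ A`, `b ∈ B`. -/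
noncomputable def tensor (A : VonNeumannAlgebra H) (B : VonNeumannAlgebra K) :
    VonNeumannAlgebra (HilbertTensor H K) :=
  generatedBy {T | ∃ a ∈ A.toStarSubalgebra, ∃ b ∈ B.toStarSubalgebra, T = tensorOp a b}

/-- The elementary tensor `a ⊗ b` as an element of the von Neumann algebra tensor product. -/
noncomputable def tmul {A : VonNeumannAlgebra H} {B : VonNeumannAlgebra K}
    (a : A.toStarSubalgebra) (b : B.toStarSubalgebra) : (A.tensor B).toStarSubalgebra :=
  ⟨tensorOp a.1 b.1, subset_generatedBy _ ⟨a.1, a.2, b.1, b.2, rfl⟩⟩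

theorem coe_tmul {A : VonNeumannAlgebra H} {B : VonNeumannAlgebra K}
    (a : A.toStarSubalgebra) (b : B.toStarSubalgebra) :
    (tmul a b : HilbertTensor H K →L[ℂ] HilbertTensor H K) = tensorOp a.1 b.1 := rfl

end Tensor

end VonNeumannAlgebra

/-! ### Normal states and the product state -/

/-- A normal state on a von Neumann algebra `A` acting on `H`: a positive unital linear functional
which is σ-weakly continuous, i.e. of the form `a ↦ ∑ᵢ ⟪xᵢ, a xᵢ⟫` with `∑ᵢ ‖xᵢ‖² < ∞`. -/
structure NormalState {H : Type u} [NormedAddCommGroup H] [InnerProductSpace ℂ H]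
    [CompleteSpace H] (A : VonNeumannAlgebra H) where
  toLin : A.toStarSubalgebra →ₗ[ℂ] ℂ
  map_one : toLin 1 = 1
  nonneg : ∀ a, 0 ≤ (toLin (star a * a)).re ∧ (toLin (star a * a)).im = 0
  normal : ∃ x : ℕ → H, Summable (fun i => ‖x i‖ ^ 2) ∧
    ∀ a : A.toStarSubalgebra,
      HasSum (fun i => inner ℂ (x i) ((a : H →L[ℂ] H) (x i))) (toLin a)

namespace NormalState

theorem hasSum_mul_unpair {f g : ℕ → ℂ} {s t : ℂ} (hf : HasSum f s) (hg : HasSum g t) :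
    HasSum (fun n : ℕ => f n.unpair.1 * g n.unpair.2) (s * t) := by
  have hs : Summable fun p : ℕ × ℕ => f p.1 * g p.2 :=
    summable_mul_of_summable_norm hf.summable.norm hg.summable.norm
  have h : HasSum (fun p : ℕ × ℕ => f p.1 * g p.2) (s * t) := hf.mul hg hs
  exact (Nat.pairEquiv.symm.hasSum_iff (f := fun p : ℕ × ℕ => f p.1 * g p.2) (a := s * t)).2 h

section OfVectors

variable {H : Type u} [NormedAddCommGroup H] [InnerProductSpace ℂ H] [CompleteSpace H]

theorem summable_inner_apply {x : ℕ → H} (hx : Summable (fun i => ‖x i‖ ^ 2)) (T : H →L[ℂ] H) :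
    Summable (fun i => inner ℂ (x i) (T (x i))) := by
  refine Summable.of_norm_bounded (hx.mul_left ‖T‖) fun i => ?_
  calc ‖inner ℂ (x i) (T (x i))‖ ≤ ‖x i‖ * ‖T (x i)‖ := norm_inner_le_norm _ _
    _ ≤ ‖x i‖ * (‖T‖ * ‖x i‖) := by gcongr; exact T.le_opNorm _
    _ = ‖T‖ * ‖x i‖ ^ 2 := by ring

/-- The normal state `T ↦ ∑ᵢ ⟪xᵢ, T xᵢ⟫` given by vectors with `∑ᵢ ‖xᵢ‖² = 1`. -/
noncomputable def ofVectors (A : VonNeumannAlgebra H) (x : ℕ → H)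
    (hx : HasSum (fun i => ‖x i‖ ^ 2) 1) : NormalState A where
  toLin :=
    { toFun := fun T => ∑' i, inner ℂ (x i) ((T : H →L[ℂ] H) (x i))
      map_add' := fun S T => by
        rw [← (summable_inner_apply hx.summable _).tsum_add (summable_inner_apply hx.summable _)]
        exact tsum_congr fun i => by simp
      map_smul' := fun c T => by
        simp only [RingHom.id_apply, smul_eq_mul]
        rw [← tsum_mul_left]
        exact tsum_congr fun i => by simp }
  map_one := by
    have h : HasSum (fun i => ((‖x i‖ ^ 2 : ℝ) : ℂ)) ((1 : ℝ) : ℂ) := Complex.hasSum_ofReal.2 hx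
    have h' := h.tsum_eq
    simp only [LinearMap.coe_mk, AddHom.coe_mk]
    rw [← Complex.ofReal_one, ← h']
    exact tsum_congr fun i => by simp [inner_self_eq_norm_sq_to_K]
  nonneg := fun a => by
    have h : ∀ i, inner ℂ (x i)
        (((star a * a : A.toStarSubalgebra) : H →L[ℂ] H) (x i)) =
        ((‖(a : H →L[ℂ] H) (x i)‖ ^ 2 : ℝ) : ℂ) := fun i => by
      have : (((star a * a : A.toStarSubalgebra) : H →L[ℂ] H) (x i)) =
          ContinuousLinearMap.adjoint (a : H →L[ℂ] H) ((a : H →L[ℂ] H) (x i)) := rfl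
      rw [this, ContinuousLinearMap.adjoint_inner_right, inner_self_eq_norm_sq_to_K]
      simp
    simp only [LinearMap.coe_mk, AddHom.coe_mk]
    rw [tsum_congr h, ← Complex.ofReal_tsum]
    exact ⟨by simpa using tsum_nonneg fun i => by positivity, Complex.ofReal_im _⟩
  normal := ⟨x, hx.summable, fun a => (summable_inner_apply hx.summable _).hasSum⟩

theorem ofVectors_apply (A : VonNeumannAlgebra H) (x : ℕ → H)
    (hx : HasSum (fun i => ‖x i‖ ^ 2) 1) (T : A.toStarSubalgebra) :
    (ofVectors A x hx).toLin T = ∑' i, inner ℂ (x i) ((T : H →L[ℂ] H) (x i)) := rfl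

theorem hasSum_norm_sq {A : VonNeumannAlgebra H} (φ : NormalState A) {x : ℕ → H}
    (hx : ∀ a : A.toStarSubalgebra,
      HasSum (fun i => inner ℂ (x i) ((a : H →L[ℂ] H) (x i))) (φ.toLin a)) :
    HasSum (fun i => ‖x i‖ ^ 2) 1 := by
  have h := hx 1
  rw [φ.map_one] at h
  rw [← Complex.hasSum_ofReal]
  simpa [inner_self_eq_norm_sq_to_K] using h

end OfVectors

section Prod

variable {H : Type u} [NormedAddCommGroup H] [InnerProductSpace ℂ H] [CompleteSpace H]
variable {K : Type v} [NormedAddCommGroup K] [InnerProductSpace ℂ K] [CompleteSpace K]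

open VonNeumannAlgebra in
theorem hasSum_norm_sq_tensorVec {x : ℕ → H} {y : ℕ → K}
    (hx : HasSum (fun i => ‖x i‖ ^ 2) 1) (hy : HasSum (fun i => ‖y i‖ ^ 2) 1) :
    HasSum (fun n : ℕ => ‖tensorVec (x n.unpair.1) (y n.unpair.2)‖ ^ 2) 1 := by
  have h := hx.mul hy (hx.summable.mul_of_nonneg hy.summable (fun _ => by positivity)
    (fun _ => by positivity))
  have h' := (Nat.pairEquiv.symm.hasSum_iff).2 h
  rw [one_mul] at h'
  convert! h' using 2 with n
  simp [norm_tensorVec, mul_pow]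

/-- The product state `φ ⊗ ψ` on the von Neumann algebra tensor product: if `φ = ∑ᵢ ⟪xᵢ, · xᵢ⟫` and
`ψ = ∑ⱼ ⟪yⱼ, · yⱼ⟫`, then `φ ⊗ ψ = ∑ᵢⱼ ⟪xᵢ ⊗ yⱼ, · (xᵢ ⊗ yⱼ)⟫`. It is the (unique) normal state
with `(φ ⊗ ψ) (a ⊗ b) = φ a * ψ b`; in particular it does not depend on the chosen vectors. -/
noncomputable def prod {A : VonNeumannAlgebra H} {B : VonNeumannAlgebra K}
    (φ : NormalState A) (ψ : NormalState B) : NormalState (A.tensor B) :=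
  ofVectors (A.tensor B)
    (fun n => VonNeumannAlgebra.tensorVec (φ.normal.choose n.unpair.1) (ψ.normal.choose n.unpair.2))
    (hasSum_norm_sq_tensorVec (φ.hasSum_norm_sq φ.normal.choose_spec.2)
      (ψ.hasSum_norm_sq ψ.normal.choose_spec.2))

open VonNeumannAlgebra in
theorem prod_tmul {A : VonNeumannAlgebra H} {B : VonNeumannAlgebra K}
    (φ : NormalState A) (ψ : NormalState B) (a : A.toStarSubalgebra) (b : B.toStarSubalgebra) :
    (φ.prod ψ).toLin (tmul a b) = φ.toLin a * ψ.toLin b := by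
  have h' := hasSum_mul_unpair (φ.normal.choose_spec.2 a) (ψ.normal.choose_spec.2 b)
  rw [prod, ofVectors_apply, ← h'.tsum_eq]
  refine tsum_congr fun n => ?_
  rw [coe_tmul, tensorOp_tensorVec, inner_tensorVec]

end Prod

end NormalState

/-! ### Freeness and semicircular variables -/

section Free

variable {H : Type u} [NormedAddCommGroup H] [InnerProductSpace ℂ H] [CompleteSpace H]

/-- Random variables `x i` are free with respect to `φ` if the von Neumann algebras they generate
are: `φ (a₀ ⋯ aₘ) = 0` whenever `φ (aⱼ) = 0`, `aⱼ` lies in the algebra generated by `x (r j)`, and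
consecutive indices `r j` are different. -/
def IsFree {A : VonNeumannAlgebra H} (φ : NormalState A) {ι : Type*}
    (x : ι → A.toStarSubalgebra) : Prop :=
  ∀ (m : ℕ) (r : Fin (m + 1) → ι) (a : Fin (m + 1) → A.toStarSubalgebra),
    (∀ j, (a j : H →L[ℂ] H) ∈
      (VonNeumannAlgebra.generatedBy {(x (r j) : H →L[ℂ] H)}).toStarSubalgebra) →
    (∀ j, φ.toLin (a j) = 0) →
    (∀ j : Fin m, r j.castSucc ≠ r j.succ) →
    φ.toLin (List.ofFn a).prod = 0

/-- The centred semicircle law of radius `r`. -/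
noncomputable def semicircleLaw (r : ℝ) : MeasureTheory.Measure ℝ :=
  MeasureTheory.volume.withDensity fun t =>
    ENNReal.ofReal ((Set.Icc (-r) r).indicator
      (fun t => 2 / (Real.pi * r ^ 2) * Real.sqrt (r ^ 2 - t ^ 2)) t)

/-- A standard semicircular: a self-adjoint random variable whose distribution is the
semicircle law of radius `2`. -/
def IsStandardSemicircular {A : VonNeumannAlgebra H} (φ : NormalState A)
    (x : A.toStarSubalgebra) : Prop :=
  IsSelfAdjoint x ∧ ∀ n : ℕ, φ.toLin (x ^ n) = ((∫ t, t ^ n ∂(semicircleLaw 2) : ℝ) : ℂ)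

end Free

/-! ### Non-crossing partitions and free cumulants -/

/-- A partition of `Fin n` is non-crossing if there are no distinct blocks `V`, `W` and
`x₁, y₁ ∈ V`, `x₂, y₂ ∈ W` with `x₁ < x₂ < y₁ < y₂`. -/
def IsNonCrossing {n : ℕ} (π : Finpartition (Finset.univ : Finset (Fin n))) : Prop :=
  ∀ V ∈ π.parts, ∀ W ∈ π.parts, V ≠ W →
    ¬ ∃ x₁ ∈ V, ∃ y₁ ∈ V, ∃ x₂ ∈ W, ∃ y₂ ∈ W, x₁ < x₂ ∧ x₂ < y₁ ∧ y₁ < y₂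

section Cumulants

variable {R : Type*} [Ring R] [Algebra ℂ R]

open Classical in
/-- The free cumulants `kₙ[a₁, …, aₙ]`, `n ≥ 1`, of a linear functional `φ`. They are defined by
`φ (a₁ ⋯ aₙ) = ∑ π ∈ NC(n), ∏ V ∈ π, k_V[a₁, …, aₙ]`, which is solved recursively for the
summand of the one-block partition: the sum below is over the other non-crossing partitions. -/
noncomputable def freeCumulant (φ : R →ₗ[ℂ] ℂ) : (n : ℕ) → (Fin n → R) → ℂ
  | n, a => φ (List.ofFn a).prod -
      ∑ π : {π : Finpartition (Finset.univ : Finset (Fin n)) //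
          IsNonCrossing π ∧ ∀ V ∈ π.parts, V.card < n},
        ∏ V : {V // V ∈ π.1.parts},
          freeCumulant φ V.1.card fun i => a (V.1.orderEmbOfFin rfl i)
  termination_by n => n
  decreasing_by exact π.2.2 V.1 V.2

open Classical in
/-- The moment-cumulant formula. -/
theorem moment_eq_sum_freeCumulant (φ : R →ₗ[ℂ] ℂ) {n : ℕ} (hn : 0 < n) (a : Fin n → R) :
    φ (List.ofFn a).prod =
      ∑ π : {π : Finpartition (Finset.univ : Finset (Fin n)) // IsNonCrossing π},
        ∏ V ∈ π.1.parts, freeCumulant φ V.card fun i => a (V.orderEmbOfFin rfl i) := by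
  have huniv : (Finset.univ : Finset (Fin n)) ≠ ∅ := by
    have : Nonempty (Fin n) := ⟨⟨0, hn⟩⟩
    exact Finset.univ_nonempty.ne_empty
  let I : Finpartition (Finset.univ : Finset (Fin n)) := Finpartition.indiscrete huniv
  have hI : I.parts = {Finset.univ} := rfl
  have hInc : IsNonCrossing I := by
    intro V hV W hW hVW
    rw [hI, Finset.mem_singleton] at hV hW
    exact absurd (hV.trans hW.symm) hVW
  have htop : ∀ π : Finpartition (Finset.univ : Finset (Fin n)),
      (∀ V ∈ π.parts, V.card < n) ↔ π ≠ I := by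
    intro π
    constructor
    · rintro h rfl
      have := h Finset.univ (by rw [hI]; exact Finset.mem_singleton_self _)
      simp at this
    · intro h V hV
      by_contra hlt
      have hVu : V = Finset.univ := by
        apply Finset.eq_univ_of_card
        have := Finset.card_le_univ V
        simp at this ⊢
        omega
      subst hVu
      apply h
      ext W
      rw [hI, Finset.mem_singleton]
      constructor
      · intro hW
        by_contra hne
        have hd : Disjoint W Finset.univ := π.disjoint hW hV hne
        exact π.ne_bot hW (hd.eq_bot_of_le (Finset.subset_univ W))
      · rintro rfl
        exact hV
  have hsum : ∀ f : Finpartition (Finset.univ : Finset (Fin n)) → ℂ,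
      ∑ π : {π : Finpartition (Finset.univ : Finset (Fin n)) // IsNonCrossing π}, f π.1 =
        f I + ∑ π : {π : Finpartition (Finset.univ : Finset (Fin n)) //
          IsNonCrossing π ∧ ∀ V ∈ π.parts, V.card < n}, f π.1 := by
    intro f
    rw [← Finset.sum_subtype (Finset.univ.filter fun π => IsNonCrossing π) (by simp) f,
      ← Finset.sum_subtype (Finset.univ.filter fun π => IsNonCrossing π ∧
        ∀ V ∈ π.parts, V.card < n) (by simp) f,
      ← Finset.add_sum_erase _ f (a := I) (by simpa using hInc)]
    congr 1
    apply Finset.sum_congr _ fun _ _ => rfl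
    ext π
    simp only [Finset.mem_erase, Finset.mem_filter, Finset.mem_univ, true_and, htop]
    tauto
  have hcast : ∀ (k : ℕ) (hk : k = n) (e : Fin k ↪o Fin n),
      freeCumulant φ k (fun i => a (e i)) = freeCumulant φ n a := by
    intro k hk e
    subst hk
    congr 1
    funext i
    congr 1
    have hs : Function.Surjective e := Finite.surjective_of_injective e.injective
    have := (StrictMono.range_inj e.strictMono strictMono_id).1 (by rw [hs.range_eq]; simp)
    exact congrFun this i
  rw [hsum fun π => ∏ V ∈ π.parts, freeCumulant φ V.card fun i => a (V.orderEmbOfFin rfl i)]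
  rw [hI, Finset.prod_singleton, hcast _ (by simp) _, freeCumulant]
  have hattach : ∀ π : Finpartition (Finset.univ : Finset (Fin n)),
      (∏ V : {V // V ∈ π.parts}, freeCumulant φ V.1.card fun i => a (V.1.orderEmbOfFin rfl i)) =
        ∏ V ∈ π.parts, freeCumulant φ V.card fun i => a (V.orderEmbOfFin rfl i) := fun π =>
    Finset.prod_coe_sort π.parts
      fun V => freeCumulant φ V.card fun i => a (V.orderEmbOfFin rfl i)
  simp only [hattach]
  ring

end Cumulants

/-! ### Meanders -/

/-- A non-crossing pairing: a non-crossing partition into blocks of size two. -/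
def IsNonCrossingPairing {n : ℕ} (π : Finpartition (Finset.univ : Finset (Fin n))) : Prop :=
  IsNonCrossing π ∧ ∀ V ∈ π.parts, V.card = 2

/-- A (multi-component) meander of order `m`, i.e. with `2 * m` bridges, up to deformations that
preserve the order of the bridges. It is given by the system of pairwise disjoint arcs above the
river and the system of pairwise disjoint arcs below the river, each joining the bridges in
pairs. -/
@[ext]
structure Meander (m : ℕ) where
  upper : Finpartition (Finset.univ : Finset (Fin (2 * m)))
  lower : Finpartition (Finset.univ : Finset (Fin (2 * m)))
  upper_pairing : IsNonCrossingPairing upper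
  lower_pairing : IsNonCrossingPairing lower

namespace Meander

variable {m : ℕ}

/-- Two bridges are joined by an arc above or below the river. -/
def Joined (μ : Meander m) (i j : Fin (2 * m)) : Prop :=
  ∃ V, (V ∈ μ.upper.parts ∨ V ∈ μ.lower.parts) ∧ i ∈ V ∧ j ∈ V

/-- The connected components (loops) of a meander. -/
def Component (μ : Meander m) : Type :=
  Quotient (Relation.EqvGen.setoid μ.Joined)

/-- The component passing through a given bridge. -/
def componentOf (μ : Meander m) (i : Fin (2 * m)) : μ.Component :=
  Quotient.mk (Relation.EqvGen.setoid μ.Joined) i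

/-- A meander is `k`-reducible if a proper non-empty collection `C` of its components can be
detached by cutting the river at (at most) `k` places between the bridges. Here `i ∈ cuts` means
that the river is cut between the bridges `i` and `i + 1`, and `C` is detached if bridges that are
still connected by the river belong both to `C` or both to the rest of the meander. -/
def IsReducible (μ : Meander m) (k : ℕ) : Prop :=
  ∃ C : Set μ.Component, C.Nonempty ∧ C ≠ Set.univ ∧
    ∃ cuts : Finset ℕ, cuts.card ≤ k ∧
      ∀ i j : Fin (2 * m), (j : ℕ) = i + 1 → (i : ℕ) ∉ cuts →
        (μ.componentOf i ∈ C ↔ μ.componentOf j ∈ C)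

/-- A meander is `k`-irreducible if it is not `k`-reducible. -/
def IsIrreducible (μ : Meander m) (k : ℕ) : Prop := ¬ μ.IsReducible k

instance : Finite (Meander m) :=
  Finite.of_injective (fun μ : Meander m => (μ.upper, μ.lower)) fun μ ν h => by
    rw [Prod.mk.injEq] at h
    exact Meander.ext h.1 h.2

end Meander

/-- The number of `2`-irreducible meanders with `2 * m` bridges. -/
noncomputable def numIrreducibleMeanders (m : ℕ) : ℕ :=
  Nat.card {μ : Meander m // μ.IsIrreducible 2}

/-! ### Non-crossing equivalence relations on linear orders -/

/-! The `n`-th moment of a standard semicircular is the number of non-crossing pairings of `n`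
points. The product state multiplies moments, so the `n`-th moment of `ξ ⊗ η` counts ordered pairs
of such pairings: the arcs above and below the river.

Non-crossing partitions are closed under intersection, so each pair has a smallest non-crossing
partition `π` coarser than both members. For fixed `π`, the pair is an independent choice, on each
block `V` of `π`, of a pair whose smallest common non-crossing coarsening is the one-block partition
of `V` (`Setoid.card_pairingsWithClosure_ker`). Hence the moment is the sum over non-crossing `π` of
`∏ numConnectedPairs V.card` (`sq_numNonCrossingPairings`). This is the moment-cumulant formula,
which determines the cumulants (`freeCumulant_const_eq_of_moments`).

It remains to see that these connected pairs are the `2`-irreducible meanders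
(`Meander.isReducible_two_iff`). Two cuts isolate an interval of bridges from its complement, which
is a non-crossing partition; conversely, a non-trivial non-crossing partition always has a proper
interval that is a union of blocks. -/

namespace Setoid

section Glue

variable {α ι : Type*}

/-- The equivalence relation on `α` which restricts to `s i` on the fibre of `c` over `i` and does
not relate points of different fibres. -/
def glue (c : α → ι) (s : ∀ i, Setoid {x // c x = i}) : Setoid α where
  r x y := ∃ h : c y = c x, s (c x) ⟨x, rfl⟩ ⟨y, h⟩
  iseqv := by
    have key : ∀ {i x y} (hx : c x = i) (hy : c y = i), s i ⟨x, hx⟩ ⟨y, hy⟩ ↔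
        ∃ h : c y = c x, s (c x) ⟨x, rfl⟩ ⟨y, h⟩ := by
      rintro i x y rfl hy
      exact ⟨fun h => ⟨hy, h⟩, fun h => h.2⟩
    refine ⟨fun x => ⟨rfl, (s _).refl _⟩, ?_, ?_⟩
    · rintro x y ⟨h, hs⟩
      exact (key h rfl).1 ((s _).symm hs)
    · rintro x y z ⟨h, hs⟩ h'
      have h2 : c z = c x := h'.1.trans h
      exact ⟨h2, (s _).trans hs ((key h h2).2 h')⟩

theorem glue_apply {c : α → ι} {s : ∀ i, Setoid {x // c x = i}} {i : ι} {x y : α}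
    (hx : c x = i) (hy : c y = i) : glue c s x y ↔ s i ⟨x, hx⟩ ⟨y, hy⟩ := by
  subst hx
  exact ⟨fun h => h.2, fun h => ⟨hy, h⟩⟩

theorem glue_le_ker (c : α → ι) (s : ∀ i, Setoid {x // c x = i}) : glue c s ≤ ker c :=
  fun _ _ h => h.1.symm

/-- The restriction of an equivalence relation to the fibre of `c` over `i`. -/
abbrev fibre (s : Setoid α) (c : α → ι) (i : ι) : Setoid {x // c x = i} :=
  s.comap Subtype.val

theorem fibre_glue (c : α → ι) (s : ∀ i, Setoid {x // c x = i}) (i : ι) :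
    (glue c s).fibre c i = s i := by
  ext x y
  exact glue_apply x.2 y.2

theorem le_iff_fibre_le {c : α → ι} {s t : Setoid α} (hs : s ≤ ker c) :
    s ≤ t ↔ ∀ i, s.fibre c i ≤ t.fibre c i :=
  ⟨fun h _ _ _ hxy => h hxy, fun h x y hxy =>
    h (c x) (x := ⟨x, rfl⟩) (y := ⟨y, (hs hxy).symm⟩) hxy⟩

theorem eq_of_fibre_eq {c : α → ι} {s t : Setoid α} (hs : s ≤ ker c) (ht : t ≤ ker c)
    (h : ∀ i, s.fibre c i = t.fibre c i) : s = t :=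
  le_antisymm ((le_iff_fibre_le hs).2 fun i => (h i).le) ((le_iff_fibre_le ht).2 fun i => (h i).ge)

end Glue

/-- Every class has exactly two elements. -/
def IsPairing {α : Type*} (s : Setoid α) : Prop :=
  ∀ x, ∃ y, y ≠ x ∧ ∀ z, s x z ↔ z = x ∨ z = y

theorem isPairing_iff_fibre {α ι : Type*} {c : α → ι} {s : Setoid α} (hs : s ≤ ker c) :
    s.IsPairing ↔ ∀ i, (s.fibre c i).IsPairing := by
  constructor
  · rintro h i ⟨x, rfl⟩
    obtain ⟨y, hy, hz⟩ := h x
    have hxy : c x = c y := hs ((hz y).2 (Or.inr rfl))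
    refine ⟨⟨y, hxy.symm⟩, by simpa using hy, fun z => ?_⟩
    simpa [Subtype.ext_iff, comap_rel] using hz z
  · intro h x
    obtain ⟨⟨y, hxy⟩, hy, hz⟩ := h (c x) ⟨x, rfl⟩
    refine ⟨y, by simpa using hy, fun z => ⟨fun hxz => ?_, ?_⟩⟩
    · simpa using (hz ⟨z, (hs hxz).symm⟩).1 hxz
    · rintro (rfl | rfl)
      · exact s.refl _
      · exact (hz ⟨z, hxy⟩).2 (Or.inr rfl)

theorem IsPairing.comap_equiv {α β : Type*} {s : Setoid β} (hs : s.IsPairing) (e : α ≃ β) :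
    (s.comap e).IsPairing := fun x => by
  obtain ⟨y, hy, hz⟩ := hs (e x)
  refine ⟨e.symm y, fun h => hy (by simp [← h]), fun z => ?_⟩
  rw [comap_rel, hz, e.apply_eq_iff_eq, e.eq_symm_apply]

section LinearOrder

variable {α β ι : Type*} [LinearOrder α] [LinearOrder β]

/-- An equivalence relation on a linear order is non-crossing if no two distinct classes are
interlaced. -/
def IsNonCrossing (s : Setoid α) : Prop :=
  ∀ ⦃a b c d : α⦄, a < b → b < c → c < d → s a c → s b d → s a b

theorem IsNonCrossing.comap {s : Setoid β} (hs : s.IsNonCrossing) {f : α → β}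
    (hf : StrictMono f) : (s.comap f).IsNonCrossing :=
  fun _ _ _ _ h₁ h₂ h₃ h h' => hs (hf h₁) (hf h₂) (hf h₃) h h'

theorem isNonCrossing_top : (⊤ : Setoid α).IsNonCrossing :=
  fun _ _ _ _ _ _ _ _ _ => trivial

theorem IsNonCrossing.fibre {s : Setoid α} (hs : s.IsNonCrossing) (c : α → ι) (i : ι) :
    (s.fibre c i).IsNonCrossing :=
  hs.comap fun _ _ h => h

/-- Two interlaced pairs of `s` are also interlaced pairs of `ker c`, which is non-crossing, so all
four points lie in one fibre. -/
theorem isNonCrossing_iff_fibre {c : α → ι} (hc : (ker c).IsNonCrossing) {s : Setoid α}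
    (hs : s ≤ ker c) : s.IsNonCrossing ↔ ∀ i, (s.fibre c i).IsNonCrossing := by
  refine ⟨fun h i => h.fibre c i, fun h x y z w hxy hyz hzw hxz hyw => ?_⟩
  have h1 : c x = c z := hs hxz
  have h2 : c y = c w := hs hyw
  have h3 : c x = c y := hc hxy hyz hzw h1 h2
  exact h (c x) (a := ⟨x, rfl⟩) (b := ⟨y, h3.symm⟩) (c := ⟨z, h1.symm⟩)
    (d := ⟨w, (h3.trans h2).symm⟩) hxy hyz hzw hxz hyw

theorem isNonCrossing_sInf {S : Set (Setoid α)} (hS : ∀ s ∈ S, s.IsNonCrossing) :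
    (sInf S).IsNonCrossing :=
  fun _ _ _ _ h₁ h₂ h₃ h h' s hs => hS s hs h₁ h₂ h₃ (h s hs) (h' s hs)

/-- A non-crossing equivalence relation all of whose classes have two elements. -/
def IsNonCrossingPairing (s : Setoid α) : Prop :=
  s.IsNonCrossing ∧ s.IsPairing

theorem isNonCrossingPairing_iff_fibre {c : α → ι} (hc : (ker c).IsNonCrossing) {s : Setoid α}
    (hs : s ≤ ker c) : s.IsNonCrossingPairing ↔ ∀ i, (s.fibre c i).IsNonCrossingPairing := by
  simp only [IsNonCrossingPairing, forall_and, isNonCrossing_iff_fibre hc hs,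
    isPairing_iff_fibre hs]

/-! ### Smallest common non-crossing coarsenings and their factorization over fibres -/

/-- `t` is the smallest non-crossing equivalence relation containing both components of `p`. -/
def IsClosure (p : Setoid α × Setoid α) (t : Setoid α) : Prop :=
  p.1 ≤ t ∧ p.2 ≤ t ∧ ∀ s : Setoid α, s.IsNonCrossing → p.1 ≤ s → p.2 ≤ s → t ≤ s

/-- Two non-crossing pairings whose smallest common non-crossing coarsening is `t`. -/
def PairingsWithClosure (t : Setoid α) : Type _ :=
  {p : Setoid α × Setoid α //
    p.1.IsNonCrossingPairing ∧ p.2.IsNonCrossingPairing ∧ IsClosure p t}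

/-- Gluing non-crossing relations on the fibres of a non-crossing `ker c` gives a non-crossing
relation, so minimality can be tested one fibre at a time. -/
theorem isClosure_ker_iff {c : α → ι} (hc : (ker c).IsNonCrossing) {p : Setoid α × Setoid α}
    (h1 : p.1 ≤ ker c) (h2 : p.2 ≤ ker c) :
    IsClosure p (ker c) ↔ ∀ i, IsClosure (p.1.fibre c i, p.2.fibre c i) ⊤ := by
  classical
  constructor
  · rintro ⟨-, -, h⟩ i
    refine ⟨le_top, le_top, fun s hs hs1 hs2 => ?_⟩
    -- To test `s` on the fibre over `i`, extend it by the full relation on every other fibre; the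
    -- glued relation is a competitor for `ker c`.
    let f : ∀ j, Setoid {x // c x = j} := Function.update (fun _ => ⊤) i s
    have hf : f i = s := Function.update_self ..
    have hf' : ∀ j, j ≠ i → f j = ⊤ := fun j hj => Function.update_of_ne hj _ _
    have key : ker c ≤ glue c f := by
      apply h
      · rw [isNonCrossing_iff_fibre hc (glue_le_ker c f)]
        intro j
        rw [fibre_glue]
        by_cases hj : j = i
        · subst hj; rwa [hf]
        · rw [hf' j hj]; exact isNonCrossing_top
      all_goals
        rw [le_iff_fibre_le (by assumption)]
        intro j
        rw [fibre_glue]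
        by_cases hj : j = i
        · subst hj; rwa [hf]
        · rw [hf' j hj]; exact le_top
    have := (le_iff_fibre_le le_rfl).1 key i
    rw [fibre_glue, hf] at this
    exact fun x y _ => this (show c x.1 = c y.1 from x.2.trans y.2.symm)
  · intro h
    refine ⟨h1, h2, fun s hs hs1 hs2 => (le_iff_fibre_le le_rfl).2 fun i => ?_⟩
    exact le_top.trans ((h i).2.2 (s.fibre c i) (hs.fibre c i)
      ((le_iff_fibre_le h1).1 hs1 i) ((le_iff_fibre_le h2).1 hs2 i))

theorem card_isNonCrossingPairing_le_ker [Fintype ι] {c : α → ι} (hc : (ker c).IsNonCrossing) :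
    Nat.card {s : Setoid α // s.IsNonCrossingPairing ∧ s ≤ ker c} =
      ∏ i, Nat.card {s : Setoid {x // c x = i} // s.IsNonCrossingPairing} := by
  rw [← Nat.card_pi]
  refine Nat.card_eq_of_bijective
    (fun s i => ⟨s.1.fibre c i, (isNonCrossingPairing_iff_fibre hc s.2.2).1 s.2.1 i⟩) ⟨?_, ?_⟩
  · intro s t h
    exact Subtype.ext (eq_of_fibre_eq s.2.2 t.2.2 fun i => congrArg Subtype.val (congrFun h i))
  · intro f
    refine ⟨⟨glue c fun i => (f i).1, ?_, glue_le_ker _ _⟩, ?_⟩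
    · rw [isNonCrossingPairing_iff_fibre hc (glue_le_ker _ _)]
      intro i
      rw [fibre_glue]
      exact (f i).2
    · funext i
      exact Subtype.ext (fibre_glue _ _ _)

theorem card_pairingsWithClosure_ker [Fintype ι] {c : α → ι} (hc : (ker c).IsNonCrossing) :
    Nat.card (PairingsWithClosure (ker c)) =
      ∏ i, Nat.card (PairingsWithClosure (⊤ : Setoid {x // c x = i})) := by
  rw [← Nat.card_pi]
  refine Nat.card_eq_of_bijective (fun p i => ⟨(p.1.1.fibre c i, p.1.2.fibre c i),
    (isNonCrossingPairing_iff_fibre hc p.2.2.2.1).1 p.2.1 i,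
    (isNonCrossingPairing_iff_fibre hc p.2.2.2.2.1).1 p.2.2.1 i,
    (isClosure_ker_iff hc p.2.2.2.1 p.2.2.2.2.1).1 p.2.2.2 i⟩) ⟨?_, ?_⟩
  · intro p q h
    have h' : ∀ i, (p.1.1.fibre c i, p.1.2.fibre c i) = (q.1.1.fibre c i, q.1.2.fibre c i) :=
      fun i => congrArg Subtype.val (congrFun h i)
    exact Subtype.ext (Prod.ext
      (eq_of_fibre_eq p.2.2.2.1 q.2.2.2.1 fun i => congrArg Prod.fst (h' i))
      (eq_of_fibre_eq p.2.2.2.2.1 q.2.2.2.2.1 fun i => congrArg Prod.snd (h' i)))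
  · intro f
    refine ⟨⟨(glue c fun i => (f i).1.1, glue c fun i => (f i).1.2), ?_, ?_, ?_⟩, ?_⟩
    · rw [isNonCrossingPairing_iff_fibre hc (glue_le_ker _ _)]
      intro i
      rw [fibre_glue]
      exact (f i).2.1
    · rw [isNonCrossingPairing_iff_fibre hc (glue_le_ker _ _)]
      intro i
      rw [fibre_glue]
      exact (f i).2.2.1
    · refine (isClosure_ker_iff hc
        (p := (glue c fun i => (f i).1.1, glue c fun i => (f i).1.2))
        (glue_le_ker c fun i => (f i).1.1) (glue_le_ker c fun i => (f i).1.2)).2 fun i => ?_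
      rw [fibre_glue, fibre_glue]
      exact (f i).2.2.2
    · funext i
      exact Subtype.ext (Prod.ext (fibre_glue _ _ _) (fibre_glue _ _ _))

/-! ### Transport along order isomorphisms -/

theorem IsNonCrossingPairing.comap_orderIso {s : Setoid β} (hs : s.IsNonCrossingPairing)
    (e : α ≃o β) : (s.comap e).IsNonCrossingPairing :=
  ⟨hs.1.comap e.strictMono, hs.2.comap_equiv e.toEquiv⟩

theorem comap_symm_comap (e : α ≃o β) (s : Setoid α) : (s.comap e.symm).comap e = s := by
  ext x y
  simp [comap_rel]

theorem comap_mono_orderIso (e : α ≃o β) {s t : Setoid β} (h : s ≤ t) : s.comap e ≤ t.comap e :=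
  fun _ _ hxy => h hxy

theorem card_isNonCrossingPairing_congr (e : α ≃o β) :
    Nat.card {s : Setoid α // s.IsNonCrossingPairing} =
      Nat.card {s : Setoid β // s.IsNonCrossingPairing} :=
  Nat.card_congr
    { toFun := fun s => ⟨s.1.comap e.symm, s.2.comap_orderIso e.symm⟩
      invFun := fun s => ⟨s.1.comap e, s.2.comap_orderIso e⟩
      left_inv := fun s => Subtype.ext (comap_symm_comap e s.1)
      right_inv := fun s => Subtype.ext (comap_symm_comap e.symm s.1) }

theorem IsClosure.comap_orderIso {p : Setoid β × Setoid β} (hp : IsClosure p ⊤) (e : α ≃o β) :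
    IsClosure (p.1.comap e, p.2.comap e) ⊤ := by
  refine ⟨le_top, le_top, fun s hs h1 h2 => ?_⟩
  have key := hp.2.2 (s.comap e.symm) (hs.comap e.symm.strictMono)
    ((comap_symm_comap e.symm p.1).ge.trans (comap_mono_orderIso e.symm h1))
    ((comap_symm_comap e.symm p.2).ge.trans (comap_mono_orderIso e.symm h2))
  rw [← comap_symm_comap e s]
  exact fun x y _ => key trivial

theorem card_pairingsWithClosure_top_congr (e : α ≃o β) :
    Nat.card (PairingsWithClosure (⊤ : Setoid α)) =
      Nat.card (PairingsWithClosure (⊤ : Setoid β)) :=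
  Nat.card_congr
    { toFun := fun p => ⟨(p.1.1.comap e.symm, p.1.2.comap e.symm),
        p.2.1.comap_orderIso e.symm, p.2.2.1.comap_orderIso e.symm,
        p.2.2.2.comap_orderIso e.symm⟩
      invFun := fun p => ⟨(p.1.1.comap e, p.1.2.comap e),
        p.2.1.comap_orderIso e, p.2.2.1.comap_orderIso e, p.2.2.2.comap_orderIso e⟩
      left_inv := fun p => Subtype.ext
        (Prod.ext (comap_symm_comap e p.1.1) (comap_symm_comap e p.1.2))
      right_inv := fun p => Subtype.ext
        (Prod.ext (comap_symm_comap e.symm p.1.1) (comap_symm_comap e.symm p.1.2)) }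

/-! ### Sorting pairs by their smallest common non-crossing coarsening -/

theorem IsClosure.unique {p : Setoid α × Setoid α} {s t : Setoid α} (hs : IsClosure p s)
    (ht : IsClosure p t) (hs' : s.IsNonCrossing) (ht' : t.IsNonCrossing) : s = t :=
  le_antisymm (hs.2.2 t ht' ht.1 ht.2.1) (ht.2.2 s hs' hs.1 hs.2.1)

theorem exists_isClosure (p : Setoid α × Setoid α) :
    ∃ t : Setoid α, t.IsNonCrossing ∧ IsClosure p t :=
  ⟨sInf {s | s.IsNonCrossing ∧ p.1 ≤ s ∧ p.2 ≤ s}, isNonCrossing_sInf fun _ h => h.1,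
    le_sInf fun _ h => h.2.1, le_sInf fun _ h => h.2.2, fun _ h h1 h2 => sInf_le ⟨h, h1, h2⟩⟩

instance [Finite α] : Finite (Setoid α) :=
  Finite.of_injective (fun s : Setoid α => s.r) fun _ _ h =>
    Setoid.ext fun a b => iff_of_eq (congrFun (congrFun h a) b)

/-- Pairs of non-crossing pairings, sorted by their smallest common non-crossing coarsening. -/
theorem card_isNonCrossingPairing_sq [Finite α] [Fintype {t : Setoid α // t.IsNonCrossing}] :
    Nat.card {s : Setoid α // s.IsNonCrossingPairing} ^ 2 =
      ∑ t : {t : Setoid α // t.IsNonCrossing}, Nat.card (PairingsWithClosure t.1) := by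
  have : ∀ t : {t : Setoid α // t.IsNonCrossing}, Finite (PairingsWithClosure t.1) :=
    fun _ => Subtype.finite
  rw [sq, ← Nat.card_prod, ← Nat.card_sigma]
  symm
  refine Nat.card_eq_of_bijective
    (fun q => (⟨q.2.1.1, q.2.2.1⟩, ⟨q.2.1.2, q.2.2.2.1⟩)) ⟨?_, ?_⟩
  · rintro ⟨⟨t, ht⟩, ⟨p, hp⟩⟩ ⟨⟨t', ht'⟩, ⟨p', hp'⟩⟩ h
    have hpp : p = p' := Prod.ext (congrArg (fun q => q.1.1) h) (congrArg (fun q => q.2.1) h)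
    subst hpp
    obtain rfl : t = t' := hp.2.2.unique hp'.2.2 ht ht'
    rfl
  · rintro ⟨⟨s, hs⟩, ⟨s', hs'⟩⟩
    obtain ⟨t, ht, htc⟩ := exists_isClosure (s, s')
    exact ⟨⟨⟨t, ht⟩, ⟨(s, s'), hs, hs', htc⟩⟩, rfl⟩

end LinearOrder

end Setoid

/-! ### Counting non-crossing pairings -/

/-- The number of non-crossing pairings of `n` points. -/
noncomputable def numNonCrossingPairings (n : ℕ) : ℕ :=
  Nat.card {s : Setoid (Fin n) // s.IsNonCrossingPairing}

theorem Setoid.card_isNonCrossingPairing {α : Type*} [LinearOrder α] [Fintype α] {n : ℕ}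
    (h : Fintype.card α = n) :
    Nat.card {s : Setoid α // s.IsNonCrossingPairing} = numNonCrossingPairings n :=
  (Setoid.card_isNonCrossingPairing_congr (Fintype.orderIsoFinOfCardEq α h)).symm

theorem numNonCrossingPairings_zero : numNonCrossingPairings 0 = 1 := by
  rw [numNonCrossingPairings, Nat.card_eq_one_iff_exists]
  refine ⟨⟨⊤, Setoid.isNonCrossing_top, fun x => x.elim0⟩, fun s => Subtype.ext ?_⟩
  ext x
  exact x.elim0

theorem numNonCrossingPairings_two : numNonCrossingPairings 2 = 1 := by
  rw [numNonCrossingPairings, Nat.card_eq_one_iff_exists]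
  refine ⟨⟨⊤, Setoid.isNonCrossing_top, fun x => ⟨1 - x, ?_, fun z => ?_⟩⟩,
    fun s => Subtype.ext ?_⟩
  · fin_cases x <;> simp
  · rw [Setoid.top_def]
    fin_cases x <;> fin_cases z <;> simp
  · have h01 : s.1 0 1 := by
      obtain ⟨y, hy, hz⟩ := s.2.2 0
      have : y = 1 := by omega
      exact (hz 1).2 (Or.inr this.symm)
    ext x y
    have : s.1 x y := by
      fin_cases x <;> fin_cases y
      exacts [s.1.refl _, h01, s.1.symm h01, s.1.refl _]
    simpa [Setoid.top_def] using! this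

/-- The position of a point relative to an arc from `0` to `b`: on the arc, below it, or to its
right. -/
def arcPosition {n : ℕ} (b x : Fin (n + 1)) : Fin 3 :=
  if x = 0 ∨ x = b then 0 else if x < b then 1 else 2

theorem arcPosition_eq_zero {n : ℕ} {b x : Fin (n + 1)} :
    arcPosition b x = 0 ↔ x = 0 ∨ x = b := by
  unfold arcPosition; split_ifs <;> simp_all

theorem arcPosition_eq_one {n : ℕ} {b x : Fin (n + 1)} :
    arcPosition b x = 1 ↔ 0 < x ∧ x < b := by
  unfold arcPosition; split_ifs <;> simp_all <;> grind

theorem arcPosition_eq_two {n : ℕ} {b x : Fin (n + 1)} :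
    arcPosition b x = 2 ↔ b < x := by
  unfold arcPosition; split_ifs <;> simp_all <;> grind

theorem isNonCrossing_ker_arcPosition {n : ℕ} (b : Fin (n + 1)) :
    (Setoid.ker (arcPosition b)).IsNonCrossing := by
  intro x y z w hxy hyz hzw hxz hyw
  rw [Setoid.ker_def] at *
  unfold arcPosition at *
  grind

/-- No pair may cross the arc from `0` to `b`, so every other pair lies entirely below it or
entirely to its right. Conversely, the fibre of position `0` is `{0, b}`, which leaves `0` no other
partner. -/
theorem isNonCrossingPairing_and_rel_iff {n : ℕ} {b : Fin (n + 1)} (hb : b ≠ 0)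
    {s : Setoid (Fin (n + 1))} :
    s.IsNonCrossingPairing ∧ s 0 b ↔
      s.IsNonCrossingPairing ∧ s ≤ Setoid.ker (arcPosition b) := by
  refine and_congr_right fun hs => ⟨fun h x y hxy => ?_, fun h => ?_⟩
  · obtain ⟨b', hb', hz⟩ := hs.2 0
    obtain rfl : b = b' := by simpa [hb] using (hz b).1 h
    have hcross : ∀ {x y}, s x y → 0 < x → x < b → b < y → False := fun {x y} hxy h1 h2 h3 => by
      have := (hz x).1 (hs.1 h1 h2 h3 h hxy)
      grind
    have h0 : ∀ {x y}, s x y → x = 0 ∨ x = b → y = 0 ∨ y = b := fun {x y} hxy hx =>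
      (hz y).1 (s.trans ((hz x).2 hx) hxy)
    rw [Setoid.ker_def]
    have := hcross hxy
    have := hcross (s.symm hxy)
    have := h0 hxy
    have := h0 (s.symm hxy)
    unfold arcPosition
    grind
  · obtain ⟨y, hy, hz⟩ := hs.2 0
    have h1 : s 0 y := (hz y).2 (Or.inr rfl)
    have h2 : arcPosition b 0 = arcPosition b y := h h1
    have h3 : y = 0 ∨ y = b := arcPosition_eq_zero.1 (h2 ▸ arcPosition_eq_zero.2 (Or.inl rfl))
    obtain rfl : y = b := by simpa [hy] using h3
    exact h1

/-- The three fibres of `arcPosition` are chosen independently: the arc itself, the `b` points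
strictly below it, and the `n - 1 - b` points to its right. -/
theorem card_isNonCrossingPairing_and_rel {n : ℕ} (b : Fin n) :
    Nat.card {s : Setoid (Fin (n + 1)) // s.IsNonCrossingPairing ∧ s 0 b.succ} =
      numNonCrossingPairings b * numNonCrossingPairings (n - 1 - b) := by
  rw [Nat.card_congr (Equiv.subtypeEquivRight fun s =>
      isNonCrossingPairing_and_rel_iff (s := s) b.succ_ne_zero),
    Setoid.card_isNonCrossingPairing_le_ker (isNonCrossing_ker_arcPosition b.succ),
    Fin.prod_univ_three, Setoid.card_isNonCrossingPairing (n := 2),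
    Setoid.card_isNonCrossingPairing (n := b), Setoid.card_isNonCrossingPairing (n := n - 1 - b),
    numNonCrossingPairings_two, one_mul]
  · rw [Fintype.card_subtype]
    simp only [arcPosition_eq_two]
    have := b.2
    simp only [Finset.filter_lt_eq_Ioi, Fin.card_Ioi, Fin.val_succ]
    omega
  · rw [Fintype.card_subtype]
    simp only [arcPosition_eq_one]
    rw [show (Finset.univ.filter fun x : Fin (n + 1) => 0 < x ∧ x < b.succ) =
      Finset.Ioo 0 b.succ by ext; simp, Fin.card_Ioo]
    simp
  · rw [Fintype.card_subtype]
    simp only [arcPosition_eq_zero]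
    rw [show (Finset.univ.filter fun x : Fin (n + 1) => x = 0 ∨ x = b.succ) =
      {0, b.succ} by ext; simp, Finset.card_pair b.succ_ne_zero.symm]

/-- Pairings are sorted by the partner `b.succ` of `0`. -/
theorem numNonCrossingPairings_succ (n : ℕ) :
    numNonCrossingPairings (n + 1) = ∑ b ∈ Finset.range n,
      numNonCrossingPairings b * numNonCrossingPairings (n - 1 - b) := by
  rw [← Fin.sum_univ_eq_sum_range
    fun b => numNonCrossingPairings b * numNonCrossingPairings (n - 1 - b)]
  simp only [← card_isNonCrossingPairing_and_rel]
  rw [← Nat.card_sigma, numNonCrossingPairings]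
  symm
  refine Nat.card_eq_of_bijective (fun q => ⟨q.2.1, q.2.2.1⟩) ⟨?_, ?_⟩
  · rintro ⟨b, s, hs, hb⟩ ⟨b', s', hs', hb'⟩ h
    obtain rfl : s = s' := congrArg Subtype.val h
    obtain rfl : b = b' := by
      obtain ⟨y, -, hz⟩ := hs.2 0
      have h1 := (hz _).1 hb
      have h2 := (hz _).1 hb'
      simp only [Fin.succ_ne_zero, false_or] at h1 h2
      exact Fin.succ_injective _ (h1.trans h2.symm)
    rfl
  · rintro ⟨s, hs⟩
    obtain ⟨y, hy, hz⟩ := hs.2 0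
    obtain ⟨b, rfl⟩ := Fin.exists_succ_eq.2 hy
    exact ⟨⟨b, s, hs, (hz _).2 (Or.inr rfl)⟩, rfl⟩

theorem Finset.sum_range_two_mul_add_one {M : Type*} [AddCommMonoid M] (f : ℕ → M) (m : ℕ) :
    ∑ b ∈ Finset.range (2 * m + 1), f b =
      ∑ i ∈ Finset.range (m + 1), f (2 * i) + ∑ i ∈ Finset.range m, f (2 * i + 1) := by
  induction m with
  | zero => simp
  | succ m ih =>
    rw [show 2 * (m + 1) + 1 = 2 * m + 1 + 1 + 1 by ring, Finset.sum_range_succ,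
      Finset.sum_range_succ, ih, Finset.sum_range_succ (fun i => f (2 * i)) (m + 1),
      Finset.sum_range_succ (fun i => f (2 * i + 1)) m, show 2 * (m + 1) = 2 * m + 1 + 1 by ring]
    abel

theorem numNonCrossingPairings_odd (m : ℕ) : numNonCrossingPairings (2 * m + 1) = 0 := by
  induction m using Nat.strong_induction_on with
  | _ m ih =>
    rw [numNonCrossingPairings_succ]
    refine Finset.sum_eq_zero fun b hb => ?_
    rw [Finset.mem_range] at hb
    -- The two indices add up to `2 * m - 1`, so exactly one of them is odd.
    obtain ⟨i, rfl | rfl⟩ := b.even_or_odd'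
    · rw [show 2 * m - 1 - 2 * i = 2 * (m - 1 - i) + 1 by omega, ih _ (by omega), mul_zero]
    · rw [ih _ (by omega), zero_mul]

theorem numNonCrossingPairings_even (m : ℕ) : numNonCrossingPairings (2 * m) = catalan m := by
  induction m using Nat.strong_induction_on with
  | _ m ih =>
    cases m with
    | zero => simpa using numNonCrossingPairings_zero
    | succ m =>
      rw [show 2 * (m + 1) = 2 * m + 1 + 1 by ring, numNonCrossingPairings_succ,
        Finset.sum_range_two_mul_add_one, catalan_succ,
        Fin.sum_univ_eq_sum_range fun i => catalan i * catalan (m - i)]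
      simp only [numNonCrossingPairings_odd, zero_mul, Finset.sum_const_zero, add_zero]
      refine Finset.sum_congr rfl fun i hi => ?_
      rw [Finset.mem_range] at hi
      rw [ih i hi, show 2 * m + 1 - 1 - 2 * i = 2 * (m - i) by omega, ih _ (by omega)]

/-! ### Moments of the semicircle law -/

-- Substitute `t = 2 sin θ`: the square root becomes `2 cos θ`, and `dt` gives the second cosine.
open MeasureTheory Real in
theorem integral_semicircleLaw_two (n : ℕ) :
    ∫ t, t ^ n ∂(semicircleLaw 2) =
      2 ^ (n + 1) / π * ∫ θ in (-(π / 2))..(π / 2), sin θ ^ n * cos θ ^ 2 := by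
  have hmeas : Measurable fun t : ℝ => ENNReal.ofReal ((Set.Icc (-2 : ℝ) 2).indicator
      (fun t => 2 / (π * 2 ^ 2) * √(2 ^ 2 - t ^ 2)) t) :=
    ENNReal.measurable_ofReal.comp
      ((by fun_prop : Measurable fun t : ℝ => 2 / (π * 2 ^ 2) * √(2 ^ 2 - t ^ 2)).indicator
        measurableSet_Icc)
  rw [semicircleLaw, integral_withDensity_eq_integral_toReal_smul hmeas (by simp)]
  have h1 : ∀ t : ℝ, (ENNReal.ofReal ((Set.Icc (-2 : ℝ) 2).indicator
      (fun t => 2 / (π * 2 ^ 2) * √(2 ^ 2 - t ^ 2)) t)).toReal • t ^ n =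
      (Set.Icc (-2 : ℝ) 2).indicator
        (fun t => 2 / (π * 2 ^ 2) * √(2 ^ 2 - t ^ 2) * t ^ n) t := by
    intro t
    rw [ENNReal.toReal_ofReal (Set.indicator_nonneg (fun _ _ => by positivity) _)]
    by_cases ht : t ∈ Set.Icc (-2 : ℝ) 2 <;> simp [ht]
  simp only [h1]
  rw [integral_indicator measurableSet_Icc, integral_Icc_eq_integral_Ioc,
    ← intervalIntegral.integral_of_le (by norm_num)]
  have hsub := intervalIntegral.integral_comp_mul_deriv (a := -(π / 2)) (b := π / 2)
    (f := fun θ => 2 * sin θ) (f' := fun θ => 2 * cos θ)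
    (g := fun t => 2 / (π * 2 ^ 2) * √(2 ^ 2 - t ^ 2) * t ^ n)
    (fun θ _ => (hasDerivAt_sin θ).const_mul 2) (by fun_prop) (by fun_prop)
  simp only [sin_neg, sin_pi_div_two, mul_neg, mul_one] at hsub
  rw [← hsub, ← intervalIntegral.integral_const_mul]
  refine intervalIntegral.integral_congr fun θ hθ => ?_
  rw [Set.uIcc_of_le (by linarith [pi_pos])] at hθ
  have hcos : 0 ≤ cos θ := cos_nonneg_of_mem_Icc hθ
  have hsqrt : √(2 ^ 2 - (2 * sin θ) ^ 2) = 2 * cos θ := by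
    rw [show (2 : ℝ) ^ 2 - (2 * sin θ) ^ 2 = (2 * cos θ) ^ 2 by
      have := sin_sq_add_cos_sq θ
      linear_combination -4 * this]
    exact sqrt_sq (by positivity)
  simp only [Function.comp_apply, hsqrt]
  have := pi_pos.ne'
  field_simp
  ring

open Real in
theorem integral_sin_pow_mul_cos_sq_odd {n : ℕ} (hn : Odd n) :
    ∫ θ in (-(π / 2))..(π / 2), sin θ ^ n * cos θ ^ 2 = 0 := by
  have h := intervalIntegral.integral_comp_neg (a := -(π / 2)) (b := π / 2)
    fun θ => sin θ ^ n * cos θ ^ 2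
  simp only [sin_neg, cos_neg, hn.neg_pow, neg_neg, neg_mul,
    intervalIntegral.integral_neg] at h
  linarith

-- Integrate the derivative of `sin θ ^ (n + 1) * cos θ ^ 3`, whose boundary values vanish.
open Real in
theorem integral_sin_pow_mul_cos_sq_succ (n : ℕ) :
    (n + 4 : ℝ) * ∫ θ in (-(π / 2))..(π / 2), sin θ ^ (n + 2) * cos θ ^ 2 =
      (n + 1) * ∫ θ in (-(π / 2))..(π / 2), sin θ ^ n * cos θ ^ 2 := by
  have h : ∫ θ in (-(π / 2))..(π / 2),
      ((n + 1) * (sin θ ^ n * cos θ ^ 2) - (n + 4) * (sin θ ^ (n + 2) * cos θ ^ 2)) =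
      sin (π / 2) ^ (n + 1) * cos (π / 2) ^ 3 - sin (-(π / 2)) ^ (n + 1) * cos (-(π / 2)) ^ 3 := by
    refine intervalIntegral.integral_eq_sub_of_hasDerivAt
      (f := fun θ => sin θ ^ (n + 1) * cos θ ^ 3) (fun θ _ => ?_)
      (Continuous.intervalIntegrable (by fun_prop) _ _)
    convert! ((hasDerivAt_sin θ).pow (n + 1)).mul ((hasDerivAt_cos θ).pow 3) using 1
    simp only [Pi.pow_apply]
    push_cast
    linear_combination (-(n : ℝ) - 1) * sin θ ^ n * cos θ ^ 2 * sin_sq_add_cos_sq θ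
  rw [intervalIntegral.integral_sub (Continuous.intervalIntegrable (by fun_prop) _ _)
    (Continuous.intervalIntegrable (by fun_prop) _ _), intervalIntegral.integral_const_mul,
    intervalIntegral.integral_const_mul] at h
  simp only [cos_neg, cos_pi_div_two] at h
  linarith

open Real in
theorem integral_cos_sq_symm : ∫ θ in (-(π / 2))..(π / 2), cos θ ^ 2 = π / 2 := by
  rw [integral_cos_sq]
  simp

/-- This is the ratio of consecutive even semicircle moments, namely `4 (2m + 1) / (2m + 4)`. -/
theorem add_two_mul_catalan_succ (m : ℕ) :
    (m + 2) * catalan (m + 1) = 2 * (2 * m + 1) * catalan m := by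
  have h1 := succ_mul_catalan_eq_centralBinom m
  have h2 := succ_mul_catalan_eq_centralBinom (m + 1)
  have h3 := Nat.succ_mul_centralBinom_succ m
  have : (m + 1) * ((m + 2) * catalan (m + 1)) = (m + 1) * (2 * (2 * m + 1) * catalan m) := by
    linear_combination (m + 1) * h2 + h3 - 2 * (2 * m + 1) * h1
  exact Nat.eq_of_mul_eq_mul_left m.succ_pos this

theorem integral_pow_semicircleLaw_two_odd {n : ℕ} (hn : Odd n) :
    ∫ t, t ^ n ∂(semicircleLaw 2) = 0 := by
  rw [integral_semicircleLaw_two, integral_sin_pow_mul_cos_sq_odd hn, mul_zero]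

theorem integral_pow_semicircleLaw_two_even (m : ℕ) :
    ∫ t, t ^ (2 * m) ∂(semicircleLaw 2) = catalan m := by
  induction m with
  | zero =>
    rw [integral_semicircleLaw_two]
    simp only [mul_zero, pow_zero, one_mul, integral_cos_sq_symm]
    simp [Real.pi_pos.ne']
  | succ m ih =>
    rw [integral_semicircleLaw_two] at ih ⊢
    have h := integral_sin_pow_mul_cos_sq_succ (2 * m)
    have hc : ((m + 2 : ℝ)) * catalan (m + 1) = 2 * (2 * m + 1) * catalan m := by
      exact_mod_cast add_two_mul_catalan_succ m
    rw [show 2 * (m + 1) = 2 * m + 2 by ring]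
    have h0 : (m + 2 : ℝ) ≠ 0 := by positivity
    apply mul_left_cancel₀ h0
    rw [hc, ← ih]
    push_cast at h
    linear_combination (2 ^ (2 * m + 2) / Real.pi) * h

/-! ### Non-crossing partitions as equivalence relations -/

namespace Finpartition

variable {α : Type*} [Fintype α] [DecidableEq α]

/-- The equivalence relation of lying in the same block. -/
def setoid (π : Finpartition (Finset.univ : Finset α)) : Setoid α :=
  Setoid.ker π.part

theorem setoid_apply {π : Finpartition (Finset.univ : Finset α)} {x y : α} :
    π.setoid x y ↔ π.part x = π.part y := Iff.rfl

theorem setoid_apply_iff_mem_part {π : Finpartition (Finset.univ : Finset α)} {x y : α} :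
    π.setoid x y ↔ y ∈ π.part x := by
  rw [setoid_apply, eq_comm]
  exact (π.mem_part_iff_part_eq_part (Finset.mem_univ _) (Finset.mem_univ _)).symm

theorem setoid_apply_iff_exists {π : Finpartition (Finset.univ : Finset α)} {x y : α} :
    π.setoid x y ↔ ∃ V ∈ π.parts, x ∈ V ∧ y ∈ V := by
  rw [setoid_apply_iff_mem_part, mem_part_iff_exists]
  exact exists_congr fun V => and_congr_right fun _ => and_comm

theorem setoid_of_mem {π : Finpartition (Finset.univ : Finset α)} {V : Finset α}
    (hV : V ∈ π.parts) {x : α} (hx : x ∈ V) (y : α) : π.setoid x y ↔ y ∈ V := by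
  rw [setoid_apply_iff_mem_part, π.part_eq_of_mem hV hx]

theorem setoid_bijective :
    Function.Bijective (setoid : Finpartition (Finset.univ : Finset α) → Setoid α) := by
  classical
  constructor
  · intro π ρ h
    have hpart : ∀ x, π.part x = ρ.part x := fun x => by
      ext y
      rw [← setoid_apply_iff_mem_part, h, setoid_apply_iff_mem_part]
    have key : ∀ {π ρ : Finpartition (Finset.univ : Finset α)},
        (∀ x, π.part x = ρ.part x) → π.parts ⊆ ρ.parts := by
      intro π ρ hpart V hV
      obtain ⟨x, hx⟩ := π.nonempty_of_mem_parts hV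
      rw [← π.part_eq_of_mem hV hx, hpart]
      exact ρ.part_mem.2 (Finset.mem_univ _)
    exact Finpartition.ext ((key hpart).antisymm (key fun x => (hpart x).symm))
  · intro s
    refine ⟨ofSetoid s, ?_⟩
    ext x y
    rw [setoid_apply_iff_mem_part, mem_part_ofSetoid_iff_rel]

/-- The block containing a given point. -/
def block (π : Finpartition (Finset.univ : Finset α)) (x : α) : {V // V ∈ π.parts} :=
  ⟨π.part x, π.part_mem.2 (Finset.mem_univ _)⟩

theorem block_eq_iff {π : Finpartition (Finset.univ : Finset α)} {x : α}
    {V : {V // V ∈ π.parts}} : π.block x = V ↔ x ∈ V.1 := by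
  rw [Subtype.ext_iff]
  exact ⟨fun h => h ▸ π.mem_part (Finset.mem_univ _), π.part_eq_of_mem V.2⟩

/-- Writing the relation as a kernel makes the fibre results applicable, with the blocks of `π` as
fibres. -/
theorem setoid_eq_ker_block (π : Finpartition (Finset.univ : Finset α)) :
    π.setoid = Setoid.ker π.block := by
  ext x y
  exact (Subtype.ext_iff (a1 := π.block x) (a2 := π.block y)).symm

theorem isPairing_setoid_iff {π : Finpartition (Finset.univ : Finset α)} :
    π.setoid.IsPairing ↔ ∀ V ∈ π.parts, V.card = 2 := by
  constructor
  · intro h V hV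
    obtain ⟨x, hx⟩ := π.nonempty_of_mem_parts hV
    obtain ⟨y, hy, hz⟩ := h x
    rw [Finset.card_eq_two]
    refine ⟨x, y, hy.symm, ?_⟩
    ext z
    rw [← setoid_of_mem hV hx, hz]
    simp
  · intro h x
    have hV : π.part x ∈ π.parts := π.part_mem.2 (Finset.mem_univ _)
    have hx : x ∈ π.part x := π.mem_part (Finset.mem_univ _)
    obtain ⟨a, b, hab, hp⟩ := Finset.card_eq_two.1 (h _ hV)
    simp only [setoid_of_mem hV hx]
    rw [hp] at hx ⊢
    simp only [Finset.mem_insert, Finset.mem_singleton] at hx ⊢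
    rcases hx with rfl | rfl
    · exact ⟨b, hab.symm, fun _ => Iff.rfl⟩
    · exact ⟨a, hab, fun _ => or_comm⟩

theorem isNonCrossing_setoid_iff {n : ℕ} {π : Finpartition (Finset.univ : Finset (Fin n))} :
    π.setoid.IsNonCrossing ↔ IsNonCrossing π := by
  constructor
  · rintro h V hV W hW hVW ⟨x₁, hx₁, y₁, hy₁, x₂, hx₂, y₂, hy₂, h1, h2, h3⟩
    have := h h1 h2 h3 ((setoid_of_mem hV hx₁ _).2 hy₁) ((setoid_of_mem hW hx₂ _).2 hy₂)
    rw [setoid_of_mem hV hx₁] at this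
    exact hVW (π.eq_of_mem_parts hV hW this hx₂)
  · intro h a b c d hab hbc hcd hac hbd
    by_contra hne
    rw [setoid_apply] at hne
    exact h _ (π.part_mem.2 (Finset.mem_univ a)) _ (π.part_mem.2 (Finset.mem_univ b)) hne
      ⟨a, π.mem_part (Finset.mem_univ _), c, setoid_apply_iff_mem_part.1 hac,
        b, π.mem_part (Finset.mem_univ _), d, setoid_apply_iff_mem_part.1 hbd, hab, hbc, hcd⟩

theorem isNonCrossingPairing_setoid_iff {n : ℕ}
    {π : Finpartition (Finset.univ : Finset (Fin n))} :
    π.setoid.IsNonCrossingPairing ↔ IsNonCrossingPairing π :=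
  and_congr isNonCrossing_setoid_iff isPairing_setoid_iff

end Finpartition

/-! ### The squared pairing numbers as a sum over non-crossing partitions -/

/-- The number of pairs of non-crossing pairings of `n` points without a common non-crossing
coarsening other than the trivial one. -/
noncomputable def numConnectedPairs (n : ℕ) : ℕ :=
  Nat.card (Setoid.PairingsWithClosure (⊤ : Setoid (Fin n)))

theorem card_pairingsWithClosure_setoid {n : ℕ}
    {π : Finpartition (Finset.univ : Finset (Fin n))} (hπ : IsNonCrossing π) :
    Nat.card (Setoid.PairingsWithClosure π.setoid) =
      ∏ V ∈ π.parts, numConnectedPairs V.card := by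
  rw [← Finpartition.isNonCrossing_setoid_iff] at hπ
  rw [Finpartition.setoid_eq_ker_block] at hπ ⊢
  rw [Setoid.card_pairingsWithClosure_ker hπ,
    ← Finset.prod_coe_sort π.parts fun V => numConnectedPairs V.card]
  refine Finset.prod_congr rfl fun V _ => ?_
  refine (Setoid.card_pairingsWithClosure_top_congr (Fintype.orderIsoFinOfCardEq _ ?_)).symm
  rw [Fintype.card_subtype]
  simp [Finpartition.block_eq_iff]

-- Summing the blockwise product over all possible coarsenings gives the moment-cumulant formula
-- with `numConnectedPairs` in the role of the cumulants.
open Classical in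
theorem sq_numNonCrossingPairings (n : ℕ) :
    numNonCrossingPairings n ^ 2 =
      ∑ π : {π : Finpartition (Finset.univ : Finset (Fin n)) // IsNonCrossing π},
        ∏ V ∈ π.1.parts, numConnectedPairs V.card := by
  have : Fintype {t : Setoid (Fin n) // t.IsNonCrossing} := Fintype.ofFinite _
  rw [numNonCrossingPairings, Setoid.card_isNonCrossingPairing_sq]
  symm
  refine Fintype.sum_bijective
    (fun π => ⟨π.1.setoid, Finpartition.isNonCrossing_setoid_iff.2 π.2⟩) ⟨?_, ?_⟩ _ _
    fun π => (card_pairingsWithClosure_setoid π.2).symm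
  · intro π ρ h
    exact Subtype.ext (Finpartition.setoid_bijective.1 (congrArg Subtype.val h))
  · rintro ⟨s, hs⟩
    obtain ⟨π, rfl⟩ := Finpartition.setoid_bijective.2 s
    exact ⟨⟨π, Finpartition.isNonCrossing_setoid_iff.1 hs⟩, rfl⟩

theorem numConnectedPairs_odd {n : ℕ} (hn : Odd n) : numConnectedPairs n = 0 := by
  obtain ⟨m, rfl⟩ := hn
  have h := numNonCrossingPairings_odd m
  rw [numNonCrossingPairings, Nat.card_eq_zero,
    or_iff_left (not_infinite_iff_finite.2 inferInstance)] at h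
  have : IsEmpty (Setoid.PairingsWithClosure (⊤ : Setoid (Fin (2 * m + 1)))) :=
    ⟨fun p => h.false ⟨p.1.1, p.2.1⟩⟩
  rw [numConnectedPairs, Nat.card_of_isEmpty]

/-! ### Moments determine free cumulants -/

open Classical in
/-- The moment-cumulant formula determines the free cumulants. -/
theorem freeCumulant_const_eq_of_moments {R : Type*} [Ring R] [Algebra ℂ R] (φ : R →ₗ[ℂ] ℂ)
    (x : R) (κ : ℕ → ℂ)
    (h : ∀ n, φ (x ^ n) =
      ∑ π : {π : Finpartition (Finset.univ : Finset (Fin n)) // IsNonCrossing π},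
        ∏ V ∈ π.1.parts, κ V.card) :
    ∀ n, 0 < n → freeCumulant φ n (fun _ => x) = κ n := by
  intro n
  induction n using Nat.strong_induction_on with
  | _ n ih =>
    intro hn
    have hne : (Finset.univ : Finset (Fin n)) ≠ ⊥ :=
      (Finset.univ_nonempty_iff.2 ⟨⟨0, hn⟩⟩).ne_empty
    have hI : (Finpartition.indiscrete hne).parts = {Finset.univ} := rfl
    have hInc : IsNonCrossing (Finpartition.indiscrete hne) := by
      intro V hV W hW hVW
      rw [hI, Finset.mem_singleton] at hV hW
      exact absurd (hV.trans hW.symm) hVW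
    have h1 := moment_eq_sum_freeCumulant φ hn fun _ => x
    -- Subtract the two expansions of the same moment. By induction all terms cancel except that of
    -- the one-block partition, which contains the `n`-th cumulant.
    rw [List.ofFn_const, List.prod_replicate, h n, ← sub_eq_zero, ← Finset.sum_sub_distrib,
      Finset.sum_eq_single ⟨_, hInc⟩] at h1
    · have hc : ∀ k, k = n → freeCumulant φ k (fun _ => x) = freeCumulant φ n fun _ => x := by
        rintro _ rfl
        rfl
      simp only [hI, Finset.prod_singleton] at h1
      rw [hc _ (Finset.card_fin n), Finset.card_fin, sub_eq_zero] at h1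
      exact h1.symm
    · rintro ⟨π, hπ⟩ - hπI
      rw [sub_eq_zero]
      refine Finset.prod_congr rfl fun V hV => (ih _ ?_ ?_).symm
      · by_contra hlt
        have hVu : V = Finset.univ := by
          refine Finset.eq_univ_of_card _ (le_antisymm (Finset.card_le_univ V) ?_)
          simpa using hlt
        subst hVu
        refine hπI (Subtype.ext (Finpartition.ext ?_))
        rw [hI, Finset.eq_singleton_iff_unique_mem]
        refine ⟨hV, fun W hW => ?_⟩
        by_contra hWne
        exact π.ne_bot hW ((π.disjoint hW hV hWne).eq_bot_of_le (Finset.subset_univ W))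
      · exact Finset.card_pos.2 (π.nonempty_of_mem_parts hV)
    · exact fun hmem => absurd (Finset.mem_univ _) hmem

/-! ### Irreducible meanders -/

namespace Meander

variable {m : ℕ}

theorem joined_iff (μ : Meander m) {i j : Fin (2 * m)} :
    μ.Joined i j ↔ μ.upper.setoid i j ∨ μ.lower.setoid i j := by
  simp only [Finpartition.setoid_apply_iff_exists, ← exists_or, ← or_and_right]
  rfl

theorem componentOf_eq_of_joined (μ : Meander m) {i j : Fin (2 * m)} (h : μ.Joined i j) :
    μ.componentOf i = μ.componentOf j :=
  Quotient.sound (s := Relation.EqvGen.setoid μ.Joined) (Relation.EqvGen.rel _ _ h)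

theorem rel_of_componentOf_eq (μ : Meander m) {s : Setoid (Fin (2 * m))}
    (h1 : μ.upper.setoid ≤ s) (h2 : μ.lower.setoid ≤ s) {i j : Fin (2 * m)}
    (h : μ.componentOf i = μ.componentOf j) : s i j := by
  have h' : Relation.EqvGen μ.Joined i j :=
    Quotient.exact (s := Relation.EqvGen.setoid μ.Joined) h
  clear h
  induction h' with
  | rel x y h => exact (μ.joined_iff.1 h).elim (fun h => h1 h) fun h => h2 h
  | refl x => exact s.refl x
  | symm x y _ ih => exact s.symm ih
  | trans x y z _ _ ih ih' => exact s.trans ih ih'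

/-- If the value of `P` changes only at the places in `cuts`, then a change of `P` between `i`
and `j` requires a cut between `i` and `j`. -/
theorem exists_cut {n : ℕ} {P : Fin n → Prop} {cuts : Finset ℕ}
    (h : ∀ i j : Fin n, (j : ℕ) = i + 1 → (i : ℕ) ∉ cuts → (P i ↔ P j)) {i j : Fin n}
    (hij : i < j) (hP : ¬ (P i ↔ P j)) : ∃ k ∈ cuts, (i : ℕ) ≤ k ∧ k < j := by
  by_contra! hcut
  have key : ∀ d : ℕ, ∀ hd : i + d < n, i + d ≤ j → (P i ↔ P ⟨i + d, hd⟩) := by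
    intro d
    induction d with
    | zero => intros; rfl
    | succ d ih =>
      intro hd hdj
      refine (ih (by omega) (by omega)).trans (h _ _ (by simp; omega) fun hmem => ?_)
      have := hcut _ hmem (by simp)
      simp at this
      omega
  have hij' : (i : ℕ) < j := hij
  have := key (j - i) (by omega) (by omega)
  have hj : (⟨i + (j - i), by omega⟩ : Fin n) = j := Fin.ext (by simp; omega)
  rw [hj] at this
  exact hP this

/-- Detaching by two cuts amounts to splitting the bridges into an interval and its complement, both
unions of components. Such a splitting is non-crossing, and any `s ≠ ⊤` as on the right yields one:
a gap in the class of the first bridge. -/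
theorem isReducible_two_iff (μ : Meander m) :
    μ.IsReducible 2 ↔ ∃ s : Setoid (Fin (2 * m)), s.IsNonCrossing ∧ μ.upper.setoid ≤ s ∧
      μ.lower.setoid ≤ s ∧ s ≠ ⊤ := by
  constructor
  · rintro ⟨C, hC, hC', cuts, hcard, hcuts⟩
    let s : Setoid (Fin (2 * m)) := Setoid.ker fun i => μ.componentOf i ∈ C
    have hs : ∀ {i j}, s i j ↔ (μ.componentOf i ∈ C ↔ μ.componentOf j ∈ C) := fun {i j} =>
      eq_iff_iff
    refine ⟨s, ?_, fun i j h => hs.2 ?_, fun i j h => hs.2 ?_, ?_⟩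
    · intro a b c d hab hbc hcd hac hbd
      rw [hs] at *
      by_contra hne
      -- Interlaced points of different classes make membership in `C` change three times, on
      -- consecutive disjoint stretches of river, each needing its own cut.
      obtain ⟨k₁, hk₁, h₁, h₁'⟩ := exists_cut hcuts hab hne
      obtain ⟨k₂, hk₂, h₂, h₂'⟩ := exists_cut hcuts hbc (by tauto)
      obtain ⟨k₃, hk₃, h₃, h₃'⟩ := exists_cut hcuts hcd (by tauto)
      have : 2 < cuts.card :=
        Finset.two_lt_card.2 ⟨k₁, hk₁, k₂, hk₂, k₃, hk₃, by omega, by omega, by omega⟩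
      omega
    · rw [μ.componentOf_eq_of_joined (μ.joined_iff.2 (Or.inl h))]
    · rw [μ.componentOf_eq_of_joined (μ.joined_iff.2 (Or.inr h))]
    · intro htop
      obtain ⟨c, hc⟩ := hC
      obtain ⟨d, hd⟩ := (Set.ne_univ_iff_exists_notMem C).1 hC'
      obtain ⟨i, rfl⟩ := Quotient.exists_rep c
      obtain ⟨j, rfl⟩ := Quotient.exists_rep d
      have hij : s i j := by rw [htop]; trivial
      exact hd ((hs.1 hij).1 hc)
  · rintro ⟨s, hs, h1, h2, htop⟩
    have hm : 0 < 2 * m := by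
      by_contra h0
      refine htop (Setoid.ext fun i => ?_)
      have := i.2
      omega
    let o : Fin (2 * m) := ⟨0, hm⟩
    -- The first gap of the class of the first bridge `o` is `[a, b)`: `a` is the first bridge
    -- outside the class, and `b` the next one inside it.
    have hex : ∃ a : ℕ, ∃ h : a < 2 * m, ¬ s o ⟨a, h⟩ := by
      by_contra! hall
      exact htop (eq_top_iff.2 fun i j _ => s.trans (s.symm (hall i i.2)) (hall j j.2))
    classical
    obtain ⟨ha, hsa⟩ := Nat.find_spec hex
    have hmin := fun k => Nat.find_min hex (m := k)
    set a := Nat.find hex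
    -- If the class never resumes, the condition is vacuous at `2 * m`, and the gap runs to the last
    -- bridge.
    have hex' : ∃ b : ℕ, a < b ∧ ∀ h : b < 2 * m, s o ⟨b, h⟩ :=
      ⟨2 * m, ha, fun h => absurd h (lt_irrefl _)⟩
    obtain ⟨hab, hsb⟩ := Nat.find_spec hex'
    have hmin' := fun k => Nat.find_min hex' (m := k)
    set b := Nat.find hex'
    have hlt : ∀ i : Fin (2 * m), (i : ℕ) < a → s o i := fun i hi => by
      by_contra h
      exact hmin i hi ⟨i.2, h⟩
    have hmid : ∀ i : Fin (2 * m), a ≤ i → (i : ℕ) < b → ¬ s o i := fun i hi hib h => by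
      rcases hi.eq_or_lt with hia | hia
      · exact hsa (by convert h)
      · exact hmin' i hib ⟨hia, fun _ => h⟩
    -- The gap is a union of classes: a class leaving it to the left would meet the class of `o`,
    -- and one reaching past `b` would cross it along `o < i < b < j`.
    have hsat : ∀ i j : Fin (2 * m), s i j → a ≤ i → (i : ℕ) < b → a ≤ j ∧ (j : ℕ) < b := by
      intro i j hij hi hib
      have hni := hmid i hi hib
      have hnj : ¬ s o j := fun h => hni (s.trans h (s.symm hij))
      refine ⟨not_lt.1 fun h => hnj (hlt j h), not_le.1 fun h => hni ?_⟩
      have hb : b < 2 * m := h.trans_lt j.2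
      rcases h.eq_or_lt with hbj | hbj
      · exact absurd (by convert hsb hb; exact hbj.symm) hnj
      · refine hs (b := i) (c := ⟨b, hb⟩) (d := j) ?_ hib hbj (hsb hb) hij
        rcases Nat.eq_zero_or_pos (i : ℕ) with h0 | h0
        · exact absurd (by rw [show i = o from Fin.ext h0]) hni
        · exact h0
    have hmem : ∀ i, μ.componentOf i ∈ {c | ∃ j : Fin (2 * m), (a ≤ j ∧ (j : ℕ) < b) ∧
        μ.componentOf j = c} ↔ a ≤ i ∧ (i : ℕ) < b := fun i =>
      ⟨fun ⟨j, hj, hji⟩ => hsat j i (μ.rel_of_componentOf_eq h1 h2 hji) hj.1 hj.2,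
        fun hi => ⟨i, hi, rfl⟩⟩
    -- A cut is indexed by the bridge before it, hence `a - 1` and `b - 1`. When `b = 2 * m`, the
    -- second lies beyond the last bridge and separates nothing.
    refine ⟨{c | ∃ j : Fin (2 * m), (a ≤ j ∧ (j : ℕ) < b) ∧ μ.componentOf j = c},
      ⟨_, ⟨a, ha⟩, ⟨le_rfl, hab⟩, rfl⟩, fun huniv => ?_, {a - 1, b - 1}, Finset.card_le_two,
      fun i j hij hcut => ?_⟩
    · have := (hmem o).1 (huniv ▸ Set.mem_univ _)
      exact hmid o this.1 this.2 (s.refl o)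
    · rw [hmem, hmem]
      simp only [Finset.mem_insert, Finset.mem_singleton] at hcut
      omega

theorem isIrreducible_two_iff (μ : Meander m) :
    μ.IsIrreducible 2 ↔ Setoid.IsClosure (μ.upper.setoid, μ.lower.setoid) ⊤ := by
  rw [IsIrreducible, isReducible_two_iff]
  push Not
  simp only [Setoid.IsClosure, le_top, true_and, top_le_iff]

end Meander

theorem numIrreducibleMeanders_eq (m : ℕ) :
    numIrreducibleMeanders m = numConnectedPairs (2 * m) := by
  refine Nat.card_eq_of_bijective (fun μ => ⟨(μ.1.upper.setoid, μ.1.lower.setoid),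
    Finpartition.isNonCrossingPairing_setoid_iff.2 μ.1.upper_pairing,
    Finpartition.isNonCrossingPairing_setoid_iff.2 μ.1.lower_pairing,
    μ.1.isIrreducible_two_iff.1 μ.2⟩) ⟨?_, ?_⟩
  · intro μ ν h
    have h' := congrArg Subtype.val h
    exact Subtype.ext (Meander.ext (Finpartition.setoid_bijective.1 (congrArg Prod.fst h'))
      (Finpartition.setoid_bijective.1 (congrArg Prod.snd h')))
  · rintro ⟨⟨s, t⟩, hs, ht, hst⟩
    obtain ⟨π, rfl⟩ := Finpartition.setoid_bijective.2 s
    obtain ⟨ρ, rfl⟩ := Finpartition.setoid_bijective.2 t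
    exact ⟨⟨⟨π, ρ, Finpartition.isNonCrossingPairing_setoid_iff.1 hs,
      Finpartition.isNonCrossingPairing_setoid_iff.1 ht⟩,
      (Meander.isIrreducible_two_iff _).2 hst⟩, rfl⟩

/-! ### Moments of elementary tensors -/

namespace VonNeumannAlgebra

variable {H : Type u} [NormedAddCommGroup H] [InnerProductSpace ℂ H] [CompleteSpace H]
variable {K : Type v} [NormedAddCommGroup K] [InnerProductSpace ℂ K] [CompleteSpace K]

/-- Elementary tensors span a dense subspace, and both operators are continuous. -/
theorem hilbertTensor_ext {S T : HilbertTensor H K →L[ℂ] HilbertTensor H K}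
    (h : ∀ x y, S (tensorVec x y) = T (tensorVec x y)) : S = T := by
  refine ContinuousLinearMap.ext fun z => ?_
  refine UniformSpace.Completion.induction_on z
    (isClosed_eq S.continuous T.continuous) fun w => ?_
  induction w using TensorProduct.induction_on with
  | zero => rw [UniformSpace.Completion.coe_zero, map_zero, map_zero]
  | tmul x y => exact h x y
  | add w₁ w₂ h₁ h₂ => rw [UniformSpace.Completion.coe_add, map_add, map_add, h₁, h₂]

theorem tensorOp_one : tensorOp (1 : H →L[ℂ] H) (1 : K →L[ℂ] K) = 1 :=
  hilbertTensor_ext fun x y => by rw [tensorOp_tensorVec]; rfl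

theorem tensorOp_mul (a a' : H →L[ℂ] H) (b b' : K →L[ℂ] K) :
    tensorOp (a * a') (b * b') = tensorOp a b * tensorOp a' b' :=
  hilbertTensor_ext fun x y => by
    rw [mul_apply_eq_comp, tensorOp_tensorVec, tensorOp_tensorVec,
      tensorOp_tensorVec]
    rfl

theorem tmul_pow {A : VonNeumannAlgebra H} {B : VonNeumannAlgebra K}
    (a : A.toStarSubalgebra) (b : B.toStarSubalgebra) (n : ℕ) :
    tmul a b ^ n = tmul (a ^ n) (b ^ n) := by
  induction n with
  | zero => exact Subtype.ext tensorOp_one.symm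
  | succ n ih =>
    rw [pow_succ, pow_succ, pow_succ, ih]
    exact Subtype.ext (tensorOp_mul _ _ _ _).symm

end VonNeumannAlgebra

/-! ### Cumulants of the tensor product of two semicirculars -/

theorem IsStandardSemicircular.moment {H : Type*} [NormedAddCommGroup H] [InnerProductSpace ℂ H]
    [CompleteSpace H] {A : VonNeumannAlgebra H} {φ : NormalState A} {x : A.toStarSubalgebra}
    (hx : IsStandardSemicircular φ x) (n : ℕ) :
    φ.toLin (x ^ n) = numNonCrossingPairings n := by
  rw [hx.2 n]
  obtain ⟨m, rfl | rfl⟩ := n.even_or_odd'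
  · rw [integral_pow_semicircleLaw_two_even, numNonCrossingPairings_even]
    simp
  · rw [integral_pow_semicircleLaw_two_odd (odd_two_mul_add_one m), numNonCrossingPairings_odd]
    simp

theorem freeCumulant_tmul_semicircular {H : Type*} [NormedAddCommGroup H]
    [InnerProductSpace ℂ H] [CompleteSpace H] {A : VonNeumannAlgebra H} {φ : NormalState A}
    {ξ η : A.toStarSubalgebra} (hξ : IsStandardSemicircular φ ξ)
    (hη : IsStandardSemicircular φ η) {n : ℕ} (hn : 0 < n) :
    freeCumulant (φ.prod φ).toLin n (fun _ => VonNeumannAlgebra.tmul ξ η) =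
      numConnectedPairs n := by
  refine freeCumulant_const_eq_of_moments _ _ (fun n => (numConnectedPairs n : ℂ)) (fun n => ?_)
    n hn
  rw [VonNeumannAlgebra.tmul_pow, NormalState.prod_tmul, hξ.moment, hη.moment, ← sq]
  have h := sq_numNonCrossingPairings n
  exact_mod_cast h

/-- The free cumulants of `ξ ⊗ η` count `2`-irreducible meanders. The moments of `ξ ⊗ η` are the
products of the moments of `ξ` and `η`, so the freeness hypothesis plays no role. -/
theorem mainTheorem7 {H : Type*} [NormedAddCommGroup H] [InnerProductSpace ℂ H] [CompleteSpace H]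
    (A : VonNeumannAlgebra H) (φ : NormalState A) (ξ η : A.toStarSubalgebra)
    (hξ : IsStandardSemicircular φ ξ) (hη : IsStandardSemicircular φ η)
    (hfree : IsFree φ ![ξ, η]) :
    (∀ n : ℕ, Odd n →
      freeCumulant (φ.prod φ).toLin n (fun _ => VonNeumannAlgebra.tmul ξ η) = 0) ∧
    (∀ m : ℕ, 0 < m →
      freeCumulant (φ.prod φ).toLin (2 * m) (fun _ => VonNeumannAlgebra.tmul ξ η) =
        (numIrreducibleMeanders m : ℂ)) := by
  refine ⟨fun n hn => ?_, fun m hm => ?_⟩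
  · rw [freeCumulant_tmul_semicircular hξ hη hn.pos, numConnectedPairs_odd hn, Nat.cast_zero]
  · rw [freeCumulant_tmul_semicircular hξ hη (by positivity), numIrreducibleMeanders_eq]
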